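/- For each $k\ge1$ let $N_k\ge1$ be an integer and let $q_{0k},\dots,q_{N_k-1,k}>0$ be real numbers with $\sum_{i=0}^{N_k-1}q_{ik}=1$; suppose that $N_k\ge2$ for infinitely many $k$. Divide $[0,1]$ from left to right into $N_1$ closed intervals (the cylinders of rank $1$) $\Delta_{0},\dots,\Delta_{N_1-1}$ of lengths $q_{01},\dots,q_{N_1-1,1}$, and inductively divide each cylinder $\Delta_{i_1\dots i_{k-1}}$ of rank $k-1$ from left to right into $N_k$ closed intervals $\Delta_{i_1\dots i_{k-1}i}$ (the cylinders of rank $k$) with $|\Delta_{i_1\dots i_{k-1}i}|=q_{ik}\,|\Delta_{i_1\dots i_{k-1}}|$. Let $\Phi$ be the family of the interiors of all cylinders of rank at least $1$. For a family $\Psi$ of open balls (bounded open intervals) of $\mathbb{R}$, a set $E\subset\mathbb{R}$, $\alpha\ge0$ and $\varepsilon>0$, let $\mathcal P^\alpha_\varepsilon(E,\Psi)$ be the supremum of $\sum_i|E_i|^\alpha$ over all at most countable families $\{E_i\}\subset\Psi$ of pairwise disjoint balls with diameters $|E_i|\le\varepsilon$ and $E_i\cap E\ne\varnothing$ (the empty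 family gives $0$). Put $$\mathcal P^\alpha_0(E,\Psi)=\lim_{\varepsilon\to0}\mathcal P^\alpha_\varepsilon(E,\Psi),\qquad \mathcal P^\alpha(E,\Psi)=\inf\Bigl\{\sum_j\mathcal P^\alpha_0(E_j,\Psi):E\subset\bigcup_jE_j\Bigr\},$$ the infimum being over all at most countable coverings of $E$, and $\dim_P(E,\Psi)=\inf\{\alpha\ge0:\mathcal P^\alpha(E,\Psi)=0\}$. The (uncentered) packing dimension $\dim_{P(\mathrm{unc})}(E)$ is $\dim_P(E,\Psi_0)$, where $\Psi_0$ is the family of all open balls of $\mathbb{R}$. Suppose that for every digit sequence $(i_k)_{k\ge1}$, $i_k\in\{0,\dots,N_k-1\}$, $$\lim_{k\to\infty}\frac{\ln q_{i_kk}}{\ln\bigl(q_{i_11}q_{i_22}\cdots q_{i_{k-1}(k-1)}\bigr)}=0 .$$ Then $\Phi$ is a family of open balls that is faithful for packing dimension calculation on $[0,1]$, that is, $$\dim_P(E,\Phi)=\dim_{P(\mathrm{unc})}(E)\qquad\text{for every }E\subset[0,1].$$ (No positive lower bound on the numbers $q_{ik}$ is assumed.) -/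

import Mathlib

open Set Filter Topology
open scoped NNReal ENNReal

noncomputable section

/-- The family of all open balls (of positive radius) of a metric space. -/
def openBalls (M : Type*) [MetricSpace M] : Set (Set M) :=
  {B | ∃ (c : M) (r : ℝ), 0 < r ∧ B = Metric.ball c r}

/-- `V` is an uncentered `ε`-packing of `E` by members of the family `Φ`: an at most countable
family of pairwise disjoint members of `Φ`, each of diameter at most `ε` and each meeting `E`.
The empty family is allowed. -/
structure IsUncenteredPacking {M : Type*} [MetricSpace M] (Φ : Set (Set M)) (ε : ℝ≥0∞)
    (E : Set M) (V : Set (Set M)) : Prop where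
  subset : V ⊆ Φ
  countable : V.Countable
  diam_le : ∀ B ∈ V, Metric.ediam B ≤ ε
  meets : ∀ B ∈ V, (B ∩ E).Nonempty
  disjoint : V.PairwiseDisjoint id

/-- The `α`-dimensional packing premeasure of `E` with respect to `Φ` at scale `ε`:
the supremum of `∑ |B|^α` over the uncentered `ε`-packings of `E` by members of `Φ`. -/
def packingPre {M : Type*} [MetricSpace M] (Φ : Set (Set M)) (α : ℝ≥0) (ε : ℝ≥0∞)
    (E : Set M) : ℝ≥0∞ :=
  ⨆ (V : Set (Set M)) (_ : IsUncenteredPacking Φ ε E V),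
    ∑' B : V, Metric.ediam (B : Set M) ^ (α : ℝ)

/-- The `α`-dimensional packing quasi-measure with respect to `Φ`: the limit of the premeasures
as `ε → 0+`, written as an infimum (see `tendsto_packingPre`). -/
def packingQuasi {M : Type*} [MetricSpace M] (Φ : Set (Set M)) (α : ℝ≥0) (E : Set M) : ℝ≥0∞ :=
  ⨅ (ε : ℝ≥0∞) (_ : 0 < ε), packingPre Φ α ε E

theorem packingPre_mono {M : Type*} [MetricSpace M] (Φ : Set (Set M)) (α : ℝ≥0) (E : Set M) :
    Monotone fun ε : ℝ≥0∞ => packingPre Φ α ε E := by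
  intro ε ε' h
  refine iSup_mono fun V => iSup_mono' fun hV => ⟨?_, le_rfl⟩
  exact ⟨hV.subset, hV.countable, fun B hB => (hV.diam_le B hB).trans h, hV.meets, hV.disjoint⟩

theorem tendsto_packingPre {M : Type*} [MetricSpace M] (Φ : Set (Set M)) (α : ℝ≥0) (E : Set M) :
    Tendsto (fun ε : ℝ≥0∞ => packingPre Φ α ε E) (𝓝[>] 0) (𝓝 (packingQuasi Φ α E)) := by
  have h := (packingPre_mono Φ α E).tendsto_nhdsGT 0
  rwa [sInf_image] at h

/-- The `α`-dimensional packing measure of `E` with respect to `Φ`: the infimum of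
`∑ packingQuasi Φ α (S j)` over the countable coverings `S` of `E` by subsets of `M`
(finite coverings are padded with empty sets). -/
def packingMeas {M : Type*} [MetricSpace M] (Φ : Set (Set M)) (α : ℝ≥0) (E : Set M) : ℝ≥0∞ :=
  ⨅ (S : ℕ → Set M) (_ : E ⊆ ⋃ j, S j), ∑' j, packingQuasi Φ α (S j)

/-- The (uncentered) packing dimension of `E` with respect to `Φ`:
`inf {α ≥ 0 : packingMeas Φ α E = 0}`. -/
def packingDimWrt {M : Type*} [MetricSpace M] (Φ : Set (Set M)) (E : Set M) : ℝ≥0∞ :=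
  ⨅ (α : ℝ≥0) (_ : packingMeas Φ α E = 0), (α : ℝ≥0∞)

/-- The uncentered packing dimension: all open balls are admitted in the packings. -/
def packingDim {M : Type*} [MetricSpace M] (E : Set M) : ℝ≥0∞ :=
  packingDimWrt (openBalls M) E

/-- `Φ` is a family of open balls that is faithful for the calculation of the packing dimension
of the subsets of `X`. -/
def IsFaithfulForPackingDim {M : Type*} [MetricSpace M] (Φ : Set (Set M)) (X : Set M) : Prop :=
  Φ ⊆ openBalls M ∧ ∀ E : Set M, E ⊆ X → packingDimWrt Φ E = packingDim E

/-- The data of a `Q̃`-expansion of `[0, 1]`: at step `k` (steps are counted from `0`) there are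
finitely many digits `0, …, N k - 1`, with positive weights `q k i` of sum `1`. There is more than
one digit at infinitely many steps (otherwise the subdivision of `[0, 1]` stops). -/
structure QTildeMatrix where
  N : ℕ → ℕ
  q : (k : ℕ) → Fin (N k) → ℝ
  q_pos : ∀ k i, 0 < q k i
  sum_q : ∀ k, ∑ i, q k i = 1
  frequently_two_le : ∃ᶠ k in atTop, 2 ≤ N k

namespace QTildeMatrix

/-- The digit sequences of the expansion. -/
abbrev Digits (Q : QTildeMatrix) : Type := (k : ℕ) → Fin (Q.N k)

/-- The product of the weights of the first `n` digits: the length of the cylinder of rank `n`. -/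
def len (Q : QTildeMatrix) (d : Q.Digits) (n : ℕ) : ℝ :=
  ∏ k ∈ Finset.range n, Q.q k (d k)

/-- The left endpoint of the cylinder of rank `n` given by the first `n` digits of `d`. -/
def left (Q : QTildeMatrix) (d : Q.Digits) (n : ℕ) : ℝ :=
  ∑ k ∈ Finset.range n, (∑ i ∈ Finset.univ.filter (fun i => i < d k), Q.q k i) * Q.len d k

/-- The cylinder of rank `n` given by the first `n` digits of `d`. Starting from `[0, 1]`, each
cylinder of rank `k` is divided, from left to right, into `N k` closed intervals whose lengths are
in the ratio `q k 0 : q k 1 : ⋯`; these are the cylinders of rank `k + 1`. -/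
def cylinder (Q : QTildeMatrix) (d : Q.Digits) (n : ℕ) : Set ℝ :=
  Icc (Q.left d n) (Q.left d n + Q.len d n)

/-- The family of the interiors of all cylinders of rank at least `1`. -/
def cylinderInteriors (Q : QTildeMatrix) : Set (Set ℝ) :=
  {B | ∃ (d : Q.Digits) (n : ℕ), 1 ≤ n ∧ B = interior (Q.cylinder d n)}

end QTildeMatrix

end

/-! Since cylinder interiors are open intervals, only `packingDim E ≤ packingDimWrt Φ E` needs work:
if the `α`-measure for cylinders vanishes on `E`, then for each `β > α` the `β`-measure for all
balls does too. The hypothesis says that along each expansion a cylinder of length `l` has its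
successor of length at least `c * l ^ (1 + δ)`, with `c` depending on the expansion
(`exists_mul_rpow_len_le`). Taking `c = 1 / (p + 1)` splits `[0, 1]`, minus the countably many
endpoints, into countably many sets on which `c` is uniform. On such a set, take disjoint balls of
diameter between `t / 2` and `t`. Replace each by the first cylinder of length at most `t` around
one of its points of the set. These cylinders are equal or disjoint, each serves at most six balls
(`card_le_six`), and each has length at least `c * t ^ (1 + δ)`. A finite `α`-premeasure for
cylinders therefore bounds the `β`-sum of the balls by a constant times `t ^ (β - (1 + δ) * α)`
(`sum_ediam_rpow_le`). If `(1 + δ) * α < β`, summing over dyadic `t` gives the tail of a geometric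
series, which tends to zero. -/

namespace QTildeMatrix

/-! ### Digit weights at a single step. -/

/-- The sum of the weights of the digits below `i` at step `k`. -/
noncomputable def offset (Q : QTildeMatrix) (k : ℕ) (i : Fin (Q.N k)) : ℝ :=
  ∑ j ∈ Finset.univ.filter (fun j => j < i), Q.q k j

variable (Q : QTildeMatrix)

theorem N_pos (k : ℕ) : 0 < Q.N k := by
  rcases Nat.eq_zero_or_pos (Q.N k) with h | h
  · have h1 := Q.sum_q k
    have : IsEmpty (Fin (Q.N k)) := by rw [h]; infer_instance
    simp at h1
  · exact h

theorem q_le_one (k : ℕ) (i : Fin (Q.N k)) : Q.q k i ≤ 1 := by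
  rw [← Q.sum_q k]
  exact Finset.single_le_sum (fun j _ => (Q.q_pos k j).le) (Finset.mem_univ i)

theorem q_add_q_le_one (k : ℕ) {i j : Fin (Q.N k)} (hij : i ≠ j) : Q.q k i + Q.q k j ≤ 1 := by
  rw [← Q.sum_q k, ← Finset.sum_pair hij]
  exact Finset.sum_le_sum_of_subset_of_nonneg (Finset.subset_univ _)
    fun l _ _ => (Q.q_pos k l).le

theorem offset_nonneg (k : ℕ) (i : Fin (Q.N k)) : 0 ≤ Q.offset k i :=
  Finset.sum_nonneg fun j _ => (Q.q_pos k j).le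

theorem offset_add_q (k : ℕ) (i : Fin (Q.N k)) :
    Q.offset k i + Q.q k i = ∑ j ∈ Finset.univ.filter (fun j => j ≤ i), Q.q k j := by
  have : Finset.univ.filter (fun j => j ≤ i) = insert i (Finset.univ.filter (fun j => j < i)) := by
    ext j
    simp [le_iff_eq_or_lt]
  rw [this, Finset.sum_insert (by simp), offset, add_comm]

theorem offset_add_q_le_one (k : ℕ) (i : Fin (Q.N k)) : Q.offset k i + Q.q k i ≤ 1 := by
  rw [offset_add_q, ← Q.sum_q k]
  exact Finset.sum_le_sum_of_subset_of_nonneg (Finset.subset_univ _)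
    fun l _ _ => (Q.q_pos k l).le

theorem offset_add_q_le_offset (k : ℕ) {i j : Fin (Q.N k)} (hij : i < j) :
    Q.offset k i + Q.q k i ≤ Q.offset k j := by
  rw [offset_add_q]
  refine Finset.sum_le_sum_of_subset_of_nonneg (fun l hl => ?_) fun l _ _ => (Q.q_pos k l).le
  simp only [Finset.mem_filter, Finset.mem_univ, true_and] at hl ⊢
  exact hl.trans_lt hij

/-- The least digit whose right end exceeds `y` works: its left end is the right end of its
predecessor, or zero. -/
theorem exists_digit (k : ℕ) {y : ℝ} (hy0 : 0 ≤ y) (hy1 : y < 1) :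
    ∃ i, Q.offset k i ≤ y ∧ y < Q.offset k i + Q.q k i := by
  classical
  have hne : (Finset.univ.filter fun i => y < Q.offset k i + Q.q k i).Nonempty := by
    refine ⟨⟨Q.N k - 1, Nat.sub_lt (Q.N_pos k) one_pos⟩, ?_⟩
    simp only [Finset.mem_filter, Finset.mem_univ, true_and]
    rw [offset_add_q, Finset.filter_true_of_mem, Q.sum_q]
    · exact hy1
    · intro j _
      rw [Fin.le_def]
      have := j.2
      simp only
      omega
  obtain ⟨i, hi, hmin⟩ := Finset.exists_min_image _ id hne
  simp only [Finset.mem_filter, Finset.mem_univ, true_and, id] at hi hmin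
  refine ⟨i, ?_, hi⟩
  rcases (Finset.univ.filter (fun j => j < i)).eq_empty_or_nonempty with h | h
  · simpa [offset, h] using hy0
  · obtain ⟨j, hj, hmax⟩ := Finset.exists_max_image _ id h
    simp only [Finset.mem_filter, Finset.mem_univ, true_and, id] at hj hmax
    have hset : Finset.univ.filter (fun l => l < i) = Finset.univ.filter (fun l => l ≤ j) := by
      ext l
      simp only [Finset.mem_filter, Finset.mem_univ, true_and]
      exact ⟨hmax l, fun hl => hl.trans_lt hj⟩
    rw [offset, hset, ← offset_add_q]
    by_contra! hlt
    exact absurd (hmin j hlt) (not_le.2 hj)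

/-! ### Nesting and disjointness of cylinders. -/

variable {Q} (d : Q.Digits)

@[simp] theorem len_zero : Q.len d 0 = 1 := by simp [len]

@[simp] theorem left_zero : Q.left d 0 = 0 := by simp [left]

theorem len_succ (n : ℕ) : Q.len d (n + 1) = Q.len d n * Q.q n (d n) :=
  Finset.prod_range_succ _ n

theorem left_succ (n : ℕ) : Q.left d (n + 1) = Q.left d n + Q.offset n (d n) * Q.len d n :=
  Finset.sum_range_succ _ n

theorem len_pos (n : ℕ) : 0 < Q.len d n :=
  Finset.prod_pos fun k _ => Q.q_pos k (d k)

theorem len_antitone : Antitone (Q.len d) := by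
  refine antitone_nat_of_succ_le fun n => ?_
  rw [len_succ]
  exact mul_le_of_le_one_right (len_pos d n).le (Q.q_le_one _ _)

theorem len_le_one (n : ℕ) : Q.len d n ≤ 1 := by
  simpa using len_antitone d (Nat.zero_le n)

theorem left_monotone : Monotone (Q.left d) := by
  refine monotone_nat_of_le_succ fun n => ?_
  rw [left_succ]
  have := mul_nonneg (Q.offset_nonneg n (d n)) (len_pos d n).le
  linarith

theorem left_add_len_antitone : Antitone fun n => Q.left d n + Q.len d n := by
  refine antitone_nat_of_succ_le fun n => ?_
  rw [left_succ, len_succ]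
  nlinarith [Q.offset_add_q_le_one n (d n), len_pos d n]

theorem len_congr {d d' : Q.Digits} {n : ℕ} (h : ∀ k < n, d k = d' k) :
    Q.len d n = Q.len d' n :=
  Finset.prod_congr rfl fun k hk => by rw [h k (Finset.mem_range.1 hk)]

theorem left_congr {d d' : Q.Digits} {n : ℕ} (h : ∀ k < n, d k = d' k) :
    Q.left d n = Q.left d' n :=
  Finset.sum_congr rfl fun k hk => by
    rw [h k (Finset.mem_range.1 hk),
      len_congr fun j hj => h j (hj.trans (Finset.mem_range.1 hk))]

theorem interior_cylinder (n : ℕ) :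
    interior (Q.cylinder d n) = Ioo (Q.left d n) (Q.left d n + Q.len d n) :=
  interior_Icc

theorem cylinderInteriors_subset_openBalls : Q.cylinderInteriors ⊆ openBalls ℝ := by
  rintro _ ⟨d, n, -, rfl⟩
  refine ⟨Q.left d n + Q.len d n / 2, Q.len d n / 2, half_pos (len_pos d n), ?_⟩
  rw [interior_cylinder, Real.ball_eq_Ioo]
  congr 1 <;> ring

theorem ediam_interior_cylinder (n : ℕ) :
    Metric.ediam (interior (Q.cylinder d n)) = ENNReal.ofReal (Q.len d n) := by
  rw [interior_cylinder, Real.ediam_Ioo, add_sub_cancel_left]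

/-- Cylinders that branch off at the digit `k` lie one to the left of the other. -/
theorem left_add_len_le_left {d d' : Q.Digits} {k n n' : ℕ} (h : ∀ j < k, d j = d' j)
    (hk : d k < d' k) (hn : k < n) (hn' : k < n') :
    Q.left d n + Q.len d n ≤ Q.left d' n' := by
  refine (left_add_len_antitone d (Nat.succ_le_of_lt hn)).trans
    (le_trans ?_ (left_monotone d' (Nat.succ_le_of_lt hn')))
  simp only [Nat.succ_eq_add_one]
  rw [left_succ, left_succ, len_succ, left_congr h, len_congr h]
  nlinarith [Q.offset_add_q_le_offset k hk, len_pos d' k]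

theorem disjoint_or_forall_eq (d d' : Q.Digits) (n n' : ℕ) :
    Disjoint (interior (Q.cylinder d n)) (interior (Q.cylinder d' n')) ∨
      ∀ k < min n n', d k = d' k := by
  by_cases h : ∀ k < min n n', d k = d' k
  · exact Or.inr h
  left
  push Not at h
  classical
  obtain ⟨hk, hne⟩ := Nat.find_spec h
  have hmin : ∀ j < Nat.find h, d j = d' j := fun j hj => by
    by_contra hj'
    exact Nat.find_min h hj ⟨hj.trans hk, hj'⟩
  rw [interior_cylinder, interior_cylinder, Set.disjoint_left]
  rintro x ⟨hx1, hx2⟩ ⟨hx3, hx4⟩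
  rcases lt_or_gt_of_ne hne with hlt | hlt
  · have := left_add_len_le_left hmin hlt (hk.trans_le (min_le_left _ _))
      (hk.trans_le (min_le_right _ _))
    linarith
  · have := left_add_len_le_left (fun j hj => (hmin j hj).symm) hlt
      (hk.trans_le (min_le_right _ _)) (hk.trans_le (min_le_left _ _))
    linarith

/-- Cylinders that are the first ones of length at most `t` are disjoint or equal. -/
theorem disjoint_or_eq {d d' : Q.Digits} {n n' : ℕ} {t : ℝ}
    (hn : Q.len d (n + 1) ≤ t) (hn0 : t < Q.len d n)
    (hn' : Q.len d' (n' + 1) ≤ t) (hn0' : t < Q.len d' n') :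
    Disjoint (interior (Q.cylinder d (n + 1))) (interior (Q.cylinder d' (n' + 1))) ∨
      interior (Q.cylinder d (n + 1)) = interior (Q.cylinder d' (n' + 1)) := by
  refine (disjoint_or_forall_eq d d' (n + 1) (n' + 1)).imp_right fun h => ?_
  -- With different ranks, the cylinder of lower rank would contain the other one and have length at
  -- most `t` before the other's stopping rank.
  rcases lt_trichotomy n n' with hlt | rfl | hlt
  · rw [min_eq_left (by omega)] at h
    have h1 := len_antitone d' (Nat.succ_le_of_lt hlt)
    have h2 := len_congr h
    simp only [Nat.succ_eq_add_one] at h1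
    linarith
  · rw [min_self] at h
    rw [interior_cylinder, interior_cylinder, len_congr h, left_congr h]
  · rw [min_eq_right (by omega)] at h
    have h1 := len_antitone d (Nat.succ_le_of_lt hlt)
    have h2 := len_congr h
    simp only [Nat.succ_eq_add_one] at h1
    linarith

/-! ### Expansions of points and decay of cylinder lengths. -/

/-- The choice of each digit may depend on the cylinder reached so far; the recursion runs on the
pair (left end, length). -/
theorem exists_digits (f : (n : ℕ) → ℝ → ℝ → Fin (Q.N n)) :
    ∃ d : Q.Digits, ∀ n, d n = f n (Q.left d n) (Q.len d n) := by
  let s : ℕ → ℝ × ℝ := fun n => Nat.rec (0, 1) (fun n p =>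
    (p.1 + Q.offset n (f n p.1 p.2) * p.2, p.2 * Q.q n (f n p.1 p.2))) n
  let d : Q.Digits := fun n => f n (s n).1 (s n).2
  have hs : ∀ n, (Q.left d n, Q.len d n) = s n := by
    intro n
    induction n with
    | zero => simp [s]
    | succ n ih =>
      rw [left_succ, len_succ]
      have h1 : Q.left d n = (s n).1 := by rw [← ih]
      have h2 : Q.len d n = (s n).2 := by rw [← ih]
      rw [h1, h2]
  refine ⟨d, fun n => ?_⟩
  have h1 : Q.left d n = (s n).1 := by rw [← hs n]
  have h2 : Q.len d n = (s n).2 := by rw [← hs n]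
  rw [h1, h2]

variable (Q) in
/-- The set of the endpoints of the cylinders. -/
def endpoints : Set ℝ :=
  {x | ∃ (d : Q.Digits) (n : ℕ), x = Q.left d n ∨ x = Q.left d n + Q.len d n}

theorem countable_endpoints : Q.endpoints.Countable := by
  have key : ∀ n, {p : ℝ × ℝ | ∃ d : Q.Digits, p = (Q.left d n, Q.len d n)}.Countable := by
    intro n
    induction n with
    | zero =>
      refine (countable_singleton ((0 : ℝ), (1 : ℝ))).mono ?_
      rintro _ ⟨d, rfl⟩
      simp
    | succ n ih =>
      refine (countable_iUnion fun i : Fin (Q.N n) => ih.image fun p : ℝ × ℝ =>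
        (p.1 + Q.offset n i * p.2, p.2 * Q.q n i)).mono ?_
      rintro _ ⟨d, rfl⟩
      refine mem_iUnion.2 ⟨d n, _, ⟨d, rfl⟩, ?_⟩
      simp [left_succ, len_succ]
  refine (countable_iUnion fun n => ((key n).image Prod.fst).union
    ((key n).image fun p => p.1 + p.2)).mono ?_
  rintro x ⟨d, n, rfl | rfl⟩
  · exact mem_iUnion.2 ⟨n, Or.inl ⟨_, ⟨d, rfl⟩, rfl⟩⟩
  · exact mem_iUnion.2 ⟨n, Or.inr ⟨_, ⟨d, rfl⟩, rfl⟩⟩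

/-- A point of `[0, 1]` that is no endpoint of a cylinder has an expansion. -/
theorem exists_forall_mem_interior {x : ℝ} (hx : x ∈ Icc (0 : ℝ) 1) (hx' : x ∉ Q.endpoints) :
    ∃ d : Q.Digits, ∀ n, x ∈ interior (Q.cylinder d n) := by
  classical
  let f : (n : ℕ) → ℝ → ℝ → Fin (Q.N n) := fun n a l =>
    if h : 0 ≤ (x - a) / l ∧ (x - a) / l < 1 then (Q.exists_digit n h.1 h.2).choose
    else ⟨0, Q.N_pos n⟩
  obtain ⟨d, hd⟩ := exists_digits f
  have hmem : ∀ n, Q.left d n ≤ x ∧ x < Q.left d n + Q.len d n := by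
    intro n
    induction n with
    | zero =>
      refine ⟨by simpa using hx.1, lt_of_le_of_ne (by simpa using hx.2) fun h => ?_⟩
      exact hx' ⟨d, 0, Or.inr h⟩
    | succ n ih =>
      have hl := len_pos d n
      have h : 0 ≤ (x - Q.left d n) / Q.len d n ∧ (x - Q.left d n) / Q.len d n < 1 := by
        refine ⟨div_nonneg (by linarith [ih.1]) hl.le, ?_⟩
        rw [div_lt_one hl]
        linarith [ih.2]
      have hs := (Q.exists_digit n h.1 h.2).choose_spec
      have hdn : d n = (Q.exists_digit n h.1 h.2).choose := by
        rw [hd n]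
        exact dif_pos h
      rw [← hdn, le_div_iff₀ hl, div_lt_iff₀ hl] at hs
      rw [left_succ, len_succ]
      constructor <;> nlinarith [hs.1, hs.2]
  refine ⟨d, fun n => ?_⟩
  rw [interior_cylinder]
  exact ⟨lt_of_le_of_ne (hmem n).1 fun h => hx' ⟨d, n, Or.inl h.symm⟩, (hmem n).2⟩

/-- Under the hypothesis on the digits all cylinders shrink to points. -/
theorem exists_len_le
    (hQ : ∀ d : Q.Digits, Tendsto (fun k : ℕ => Real.log (Q.q k (d k)) /
      Real.log (∏ j ∈ Finset.range k, Q.q j (d j))) atTop (𝓝 0))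
    (d : Q.Digits) {t : ℝ} (ht : 0 < t) : ∃ n, Q.len d n ≤ t := by
  classical
  by_contra! hd
  -- If the lengths along `d` stay above `t`, the weights along `d` tend to one. This does not
  -- contradict the hypothesis for `d`, so another sequence `e` is built that violates it.
  have hratio : Tendsto (fun n => Q.q n (d n)) atTop (𝓝 1) := by
    have hbdd : BddBelow (range (Q.len d)) := ⟨0, by rintro _ ⟨n, rfl⟩; exact (len_pos d n).le⟩
    have hlim := tendsto_atTop_ciInf (len_antitone d) hbdd
    have hpos : 0 < ⨅ n, Q.len d n := ht.trans_le (le_ciInf fun n => (hd n).le)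
    have := ((tendsto_add_atTop_iff_nat 1).2 hlim).div hlim hpos.ne'
    rw [div_self hpos.ne'] at this
    refine this.congr fun n => ?_
    simp only [Pi.div_apply]
    rw [len_succ, mul_div_cancel_left₀ _ (len_pos d n).ne']
  let other : ∀ n, 2 ≤ Q.N n → Fin (Q.N n) := fun n h =>
    if (d n).1 = 0 then ⟨1, by omega⟩ else ⟨0, by omega⟩
  have hother : ∀ n (h : 2 ≤ Q.N n), other n h ≠ d n := by
    intro n h heq
    have := congrArg Fin.val heq
    simp only [other] at this
    split_ifs at this with h0
    · simp [h0] at this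
    · exact h0 this.symm
  -- `e` follows `d`, except that it leaves `d` whenever the weight of the other digit is at most
  -- the current length of `e`.
  let f : (n : ℕ) → ℝ → ℝ → Fin (Q.N n) := fun n _ l =>
    if h : ∃ h : 2 ≤ Q.N n, Q.q n (other n h) ≤ l then other n h.1 else d n
  obtain ⟨e, he⟩ := exists_digits f
  have hfreq : ∀ K, ∃ k ≥ K, e k ≠ d k ∧ Q.q k (e k) ≤ Q.len e k := by
    intro K
    by_contra! hK
    have hstay : ∀ k ≥ K, e k = d k := by
      intro k hk
      by_contra hne
      refine absurd (hK k hk hne) (not_lt.2 ?_)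
      have h1 := he k
      by_cases h : ∃ h : 2 ≤ Q.N k, Q.q k (other k h) ≤ Q.len e k
      · rw [h1]
        simp only [f]
        rw [dif_pos h]
        exact h.2
      · refine absurd ?_ hne
        rw [h1]
        exact dif_neg h
    -- While `e` follows `d` its length stays bounded below, whereas the weight of the other digit
    -- is at most `1 - Q.q n (d n)`, which tends to zero; so `e` must leave `d` again.
    have hlen : ∀ k ≥ K, Q.len e K * t ≤ Q.len e k := by
      have h1 : ∀ k ≥ K, Q.len e K * Q.len d k ≤ Q.len e k := by
        intro k hk
        induction k, hk using Nat.le_induction with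
        | base => exact mul_le_of_le_one_right (len_pos e K).le (len_le_one d K)
        | succ k hk ih =>
          rw [len_succ, len_succ, hstay k hk, ← mul_assoc]
          exact mul_le_mul_of_nonneg_right ih (Q.q_pos _ _).le
      exact fun k hk => (mul_le_mul_of_nonneg_left (hd k).le (len_pos e K).le).trans (h1 k hk)
    have hev : ∀ᶠ n in atTop, 1 - Q.len e K * t < Q.q n (d n) :=
      hratio.eventually (lt_mem_nhds (by nlinarith [len_pos e K]))
    obtain ⟨k, hk2, hk1, hkK⟩ :=
      (Q.frequently_two_le.and_eventually (hev.and (eventually_ge_atTop K))).exists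
    have h : ∃ h : 2 ≤ Q.N k, Q.q k (other k h) ≤ Q.len e k :=
      ⟨hk2, by linarith [Q.q_add_q_le_one k (hother k hk2), hlen k hkK]⟩
    have h1 : e k = other k h.1 := by
      rw [he k]
      exact dif_pos h
    exact hother k hk2 (h1.symm.trans (hstay k hkK))
  -- One departure from `d` makes the length of `e` less than one, hence its logarithm negative. At
  -- later departures the ratio in the hypothesis is then at least one.
  obtain ⟨k₀, -, hk₀, -⟩ := hfreq 0
  have hlt : ∀ k > k₀, Q.len e k < 1 := by
    intro k hk
    refine (len_antitone e (Nat.succ_le_of_lt hk)).trans_lt ?_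
    rw [Nat.succ_eq_add_one, len_succ]
    have h1 := Q.q_add_q_le_one k₀ hk₀
    have h2 := Q.q_pos k₀ (d k₀)
    nlinarith [len_le_one e k₀, len_pos e k₀, Q.q_pos k₀ (e k₀)]
  obtain ⟨K, hK⟩ := eventually_atTop.1 ((hQ e).eventually (gt_mem_nhds one_pos))
  obtain ⟨k, hk, -, hle⟩ := hfreq (max K (k₀ + 1))
  have h1 := hK k ((le_max_left _ _).trans hk)
  have hneg : Real.log (Q.len e k) < 0 :=
    Real.log_neg (len_pos e k) (hlt k ((le_max_right _ _).trans hk))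
  rw [show ∏ j ∈ Finset.range k, Q.q j (e j) = Q.len e k from rfl,
    div_lt_one_of_neg hneg] at h1
  exact absurd (Real.log_le_log (Q.q_pos _ _) hle) (not_le.2 h1)

theorem exists_mul_rpow_len_le {d : Q.Digits}
    (hQ : Tendsto (fun k : ℕ => Real.log (Q.q k (d k)) /
      Real.log (∏ j ∈ Finset.range k, Q.q j (d j))) atTop (𝓝 0))
    (hd : ∃ n, Q.len d n < 1) {δ : ℝ} (hδ : 0 < δ) :
    ∃ p : ℕ, ∀ n, (1 / (p + 1 : ℝ)) * Q.len d n ^ (1 + δ) ≤ Q.len d (n + 1) := by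
  obtain ⟨n₀, hn₀⟩ := hd
  obtain ⟨K, hK⟩ := eventually_atTop.1 ((hQ.eventually (gt_mem_nhds hδ)).and
    (eventually_ge_atTop n₀))
  -- The constant absorbs the ranks up to `K`; beyond them the hypothesis gives `len ^ δ ≤ q`.
  obtain ⟨p, hp⟩ := exists_nat_one_div_lt (len_pos d (K + 1))
  have hp1 : (1 / (p + 1 : ℝ)) ≤ 1 := by
    rw [div_le_one (by positivity)]
    linarith [(Nat.cast_nonneg p : (0 : ℝ) ≤ p)]
  refine ⟨p, fun n => ?_⟩
  have hl := len_pos d n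
  rcases le_total n K with h | h
  · calc (1 / (p + 1 : ℝ)) * Q.len d n ^ (1 + δ) ≤ 1 / (p + 1 : ℝ) :=
        mul_le_of_le_one_right (by positivity)
          (Real.rpow_le_one hl.le (len_le_one d n) (by linarith))
      _ ≤ Q.len d (K + 1) := hp.le
      _ ≤ Q.len d (n + 1) := len_antitone d (by omega)
  · obtain ⟨h1, h2⟩ := hK n h
    have hlog : Real.log (Q.len d n) < 0 :=
      Real.log_neg hl ((len_antitone d h2).trans_lt hn₀)
    rw [show ∏ j ∈ Finset.range n, Q.q j (d j) = Q.len d n from rfl,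
      div_lt_iff_of_neg hlog] at h1
    have hq : Q.len d n ^ δ ≤ Q.q n (d n) := by
      rw [Real.rpow_def_of_pos hl, mul_comm, ← Real.le_log_iff_exp_le (Q.q_pos _ _)]
      exact h1.le
    calc (1 / (p + 1 : ℝ)) * Q.len d n ^ (1 + δ) ≤ Q.len d n ^ (1 + δ) :=
        mul_le_of_le_one_left (by positivity) hp1
      _ = Q.len d n * Q.len d n ^ δ := by rw [Real.rpow_add hl, Real.rpow_one]
      _ ≤ Q.len d n * Q.q n (d n) := mul_le_mul_of_nonneg_left hq hl.le
      _ = Q.len d (n + 1) := (len_succ d n).symm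

end QTildeMatrix

/-! ### Packing measures in a metric space. -/

section General

variable {M : Type*} [MetricSpace M] {Φ Ψ : Set (Set M)} {α : ℝ≥0} {E F : Set M}

theorem packingPre_le_of_subset (hΦ : Φ ⊆ Ψ) (hE : E ⊆ F) (ε : ℝ≥0∞) :
    packingPre Φ α ε E ≤ packingPre Ψ α ε F :=
  iSup_mono fun _ => iSup_mono' fun hV => ⟨⟨hV.subset.trans hΦ, hV.countable, hV.diam_le,
    fun B hB => (hV.meets B hB).mono (inter_subset_inter_right _ hE), hV.disjoint⟩, le_rfl⟩

theorem packingQuasi_le_of_subset (hΦ : Φ ⊆ Ψ) (hE : E ⊆ F) :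
    packingQuasi Φ α E ≤ packingQuasi Ψ α F :=
  iInf_mono fun ε => iInf_mono fun _ => packingPre_le_of_subset hΦ hE ε

theorem packingDimWrt_le_of_subset (hΦ : Φ ⊆ Ψ) (E : Set M) :
    packingDimWrt Φ E ≤ packingDimWrt Ψ E := by
  refine iInf_mono fun α => iInf_mono' fun h => ⟨?_, le_rfl⟩
  rw [← nonpos_iff_eq_zero, ← h]
  exact iInf_mono fun S => iInf_mono fun _ =>
    ENNReal.tsum_le_tsum fun j => packingQuasi_le_of_subset hΦ Subset.rfl

/-- Disjoint balls that all contain `x` number at most one, so the premeasure at scale `ε` is at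
most `ε ^ α`. -/
theorem packingQuasi_singleton (hα : 0 < α) (x : M) : packingQuasi Φ α {x} = 0 := by
  have hle : ∀ ε : ℝ≥0∞, packingPre Φ α ε {x} ≤ ε ^ (α : ℝ) := by
    refine fun ε => iSup₂_le fun V hV => ?_
    have hx : ∀ B ∈ V, x ∈ B := fun B hB => by
      obtain ⟨y, hy, rfl⟩ := hV.meets B hB
      exact hy
    have hsub : V.Subsingleton := fun B hB C hC => by
      by_contra hne
      exact Set.disjoint_left.1 (hV.disjoint hB hC hne) (hx B hB) (hx C hC)
    rcases hsub.eq_empty_or_singleton with rfl | ⟨B, rfl⟩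
    · simp
    · rw [tsum_singleton B fun B => Metric.ediam B ^ (α : ℝ)]
      exact ENNReal.rpow_le_rpow (hV.diam_le B rfl) α.coe_nonneg
  have h0 : Tendsto (fun ε : ℝ≥0∞ => ε ^ (α : ℝ)) (𝓝[>] 0) (𝓝 0) := by
    have := (ENNReal.continuous_rpow_const (y := (α : ℝ))).tendsto 0
    rw [ENNReal.zero_rpow_of_pos (by exact_mod_cast hα)] at this
    exact this.mono_left nhdsWithin_le_nhds
  exact nonpos_iff_eq_zero.1 (le_of_tendsto_of_tendsto' (tendsto_packingPre Φ α {x}) h0 hle)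

theorem packingMeas_eq_zero_of_countable_cover {ι : Type*} [Countable ι] (S : ι → Set M)
    (hE : E ⊆ ⋃ i, S i) (hS : ∀ i, packingQuasi Φ α (S i) = 0) : packingMeas Φ α E = 0 := by
  rcases isEmpty_or_nonempty ι with hι | hι
  · have h0 : packingQuasi Φ α (∅ : Set M) = 0 := by
      refine nonpos_iff_eq_zero.1 ((iInf₂_le 1 one_pos).trans (iSup₂_le fun V hV => ?_))
      have : V = ∅ := eq_empty_of_forall_notMem fun B hB => by simpa using hV.meets B hB
      simp [this]
    refine nonpos_iff_eq_zero.1 ((iInf₂_le (fun _ => ∅) ?_).trans ?_)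
    · simpa using hE
    · simp [h0]
  · obtain ⟨f, hf⟩ := exists_surjective_nat ι
    refine nonpos_iff_eq_zero.1 ((iInf₂_le (fun n => S (f n)) ?_).trans ?_)
    · rwa [hf.iUnion_comp]
    · simp [hS]

end General

/-! ### Comparing ball packings with cylinder packings. -/

theorem volume_eq_ediam {B : Set ℝ} (hB : B ∈ openBalls ℝ) :
    MeasureTheory.volume B = Metric.ediam B := by
  obtain ⟨c, r, -, rfl⟩ := hB
  rw [Real.ball_eq_Ioo, Real.ediam_Ioo, Real.volume_Ioo]

/-- Few disjoint intervals of length about `t` meet a given interval of length at most `t`. -/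
theorem card_le_six {F : Finset (Set ℝ)} {t a b : ℝ} (ht : 0 < t) (hab : b ≤ a + t)
    (hF : ∀ B ∈ F, B ∈ openBalls ℝ) (hdisj : (F : Set (Set ℝ)).PairwiseDisjoint id)
    (hlow : ∀ B ∈ F, ENNReal.ofReal (t / 2) ≤ Metric.ediam B)
    (hup : ∀ B ∈ F, Metric.ediam B ≤ ENNReal.ofReal t)
    (hmeet : ∀ B ∈ F, (B ∩ Ioo a b).Nonempty) : F.card ≤ 6 := by
  -- All intervals lie in one of length `3 * t` and each has length at least `t / 2`, whence six.
  have hsub : (⋃ B ∈ F, id B) ⊆ Icc (a - t) (a + 2 * t) := by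
    refine iUnion₂_subset fun B hB y hy => ?_
    obtain ⟨x, hxB, hx⟩ := hmeet B hB
    have h1 : edist x y ≤ ENNReal.ofReal t :=
      (Metric.edist_le_ediam_of_mem hxB hy).trans (hup B hB)
    rw [edist_dist, ENNReal.ofReal_le_ofReal_iff ht.le, Real.dist_eq, abs_le] at h1
    constructor <;> linarith [hx.1, hx.2, h1.1, h1.2]
  have hvol : (F.card : ℝ≥0∞) * ENNReal.ofReal (t / 2) ≤ ENNReal.ofReal (3 * t) := by
    calc (F.card : ℝ≥0∞) * ENNReal.ofReal (t / 2) = ∑ _B ∈ F, ENNReal.ofReal (t / 2) := by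
          rw [Finset.sum_const, nsmul_eq_mul]
      _ ≤ ∑ B ∈ F, MeasureTheory.volume (id B) :=
          Finset.sum_le_sum fun B hB => (hlow B hB).trans_eq (volume_eq_ediam (hF B hB)).symm
      _ = MeasureTheory.volume (⋃ B ∈ F, id B) := by
          refine (MeasureTheory.measure_biUnion_finset hdisj fun B hB => ?_).symm
          obtain ⟨c, r, -, rfl⟩ := hF B hB
          exact Metric.isOpen_ball.measurableSet
      _ ≤ MeasureTheory.volume (Icc (a - t) (a + 2 * t)) := MeasureTheory.measure_mono hsub
      _ = ENNReal.ofReal (3 * t) := by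
          rw [Real.volume_Icc]
          congr 1
          ring
  rw [← ENNReal.ofReal_natCast, ← ENNReal.ofReal_mul (Nat.cast_nonneg _),
    ENNReal.ofReal_le_ofReal_iff (by positivity)] at hvol
  have : (F.card : ℝ) ≤ 6 := by
    by_contra! h
    nlinarith
  exact_mod_cast this

namespace QTildeMatrix

variable (Q : QTildeMatrix)

/-- The points that have an expansion along which the lengths of the cylinders tend to zero and
decrease no faster than a power with exponent `s` and constant `c`. -/
def regularPoints (s c : ℝ) : Set ℝ :=
  {x | ∃ d : Q.Digits, (∀ n, x ∈ interior (Q.cylinder d n)) ∧ (∀ t > 0, ∃ n, Q.len d n ≤ t) ∧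
    ∀ n, c * Q.len d n ^ s ≤ Q.len d (n + 1)}

variable {Q}

theorem exists_stopping_cylinder {s c t x : ℝ} (hs : 0 ≤ s) (hc : 0 ≤ c)
    (hx : x ∈ Q.regularPoints s c) (ht0 : 0 < t) (ht1 : t < 1) :
    ∃ (d : Q.Digits) (n : ℕ), x ∈ interior (Q.cylinder d (n + 1)) ∧ Q.len d (n + 1) ≤ t ∧
      t < Q.len d n ∧ c * t ^ s ≤ Q.len d (n + 1) := by
  classical
  obtain ⟨d, hmem, hlen, hreg⟩ := hx
  -- The rank-zero cylinder has length `1 > t`, so the stopping rank has a predecessor.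
  have hpos : Nat.find (hlen t ht0) ≠ 0 := by
    intro h0
    have := Nat.find_spec (hlen t ht0)
    rw [h0, len_zero] at this
    linarith
  obtain ⟨n, hn⟩ := Nat.exists_eq_succ_of_ne_zero hpos
  have h1 : Q.len d (n + 1) ≤ t := by
    have := Nat.find_spec (hlen t ht0)
    rwa [hn] at this
  have h2 : t < Q.len d n := by
    have := Nat.find_min (hlen t ht0) (m := n) (by omega)
    exact not_le.1 this
  refine ⟨d, n, hmem _, h1, h2, le_trans ?_ (hreg n)⟩
  exact mul_le_mul_of_nonneg_left (Real.rpow_le_rpow ht0.le h2.le hs) hc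

/-- The balls of one size class in a packing contribute little, by comparison with the packing
by the cylinders of about the same length. -/
theorem sum_ediam_rpow_le {s c t : ℝ} (hs : 0 ≤ s) (hc : 0 < c) (ht0 : 0 < t) (ht1 : t < 1)
    {S : Set ℝ} (hS : S ⊆ Q.regularPoints s c) {α β : ℝ≥0} {ε : ℝ≥0∞}
    (hε : ENNReal.ofReal t ≤ ε) (F : Finset (Set ℝ))
    (hF : ∀ B ∈ F, B ∈ openBalls ℝ) (hdisj : (F : Set (Set ℝ)).PairwiseDisjoint id)
    (hlow : ∀ B ∈ F, ENNReal.ofReal (t / 2) ≤ Metric.ediam B)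
    (hup : ∀ B ∈ F, Metric.ediam B ≤ ENNReal.ofReal t)
    (hmeet : ∀ B ∈ F, (B ∩ S).Nonempty) :
    ∑ B ∈ F, Metric.ediam B ^ (β : ℝ) ≤ ENNReal.ofReal (6 * (c ^ (α : ℝ))⁻¹) *
      packingPre Q.cylinderInteriors α ε S * ENNReal.ofReal (t ^ (β - s * α : ℝ)) := by
  classical
  have hex : ∀ B : Set ℝ, ∃ C : Set ℝ, B ∈ F → ∃ (d : Q.Digits) (n : ℕ),
      C = interior (Q.cylinder d (n + 1)) ∧ (B ∩ S ∩ C).Nonempty ∧ Q.len d (n + 1) ≤ t ∧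
      t < Q.len d n ∧ c * t ^ s ≤ Q.len d (n + 1) := by
    intro B
    by_cases hB : B ∈ F
    · obtain ⟨x, hxB, hxS⟩ := hmeet B hB
      obtain ⟨d, n, h1, h2⟩ := exists_stopping_cylinder hs hc.le (hS hxS) ht0 ht1
      exact ⟨_, fun _ => ⟨d, n, rfl, ⟨x, ⟨hxB, hxS⟩, h1⟩, h2⟩⟩
    · exact ⟨∅, fun h => absurd h hB⟩
  choose g hg using hex
  have hcard : F.card ≤ 6 * (F.image g).card := by
    refine Finset.card_le_mul_card_image F 6 fun C hC => ?_
    obtain ⟨B, hB, rfl⟩ := Finset.mem_image.1 hC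
    obtain ⟨d, n, hgB, -, hlen, -⟩ := hg B hB
    rw [interior_cylinder] at hgB
    have hsub := Finset.filter_subset (fun B' => g B' = g B) F
    refine card_le_six (a := Q.left d (n + 1)) (b := Q.left d (n + 1) + Q.len d (n + 1)) ht0
      (by linarith) (fun B' h => hF B' (hsub h))
      (hdisj.subset (by exact_mod_cast hsub)) (fun B' h => hlow B' (hsub h))
      (fun B' h => hup B' (hsub h)) fun B' h => ?_
    obtain ⟨hB', heq⟩ := Finset.mem_filter.1 h
    obtain ⟨_, _, _, ⟨x, ⟨hx1, _⟩, hx2⟩, _⟩ := hg B' hB'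
    rw [heq, hgB] at hx2
    exact ⟨x, hx1, hx2⟩
  have hpack : IsUncenteredPacking Q.cylinderInteriors ε S (F.image g : Finset (Set ℝ)) := by
    have hrep : ∀ C ∈ (F.image g : Finset (Set ℝ)), ∃ B ∈ F, g B = C := fun C hC =>
      Finset.mem_image.1 hC
    constructor
    · intro C hC
      obtain ⟨B, hB, rfl⟩ := hrep C hC
      obtain ⟨d, n, h, -⟩ := hg B hB
      exact ⟨d, n + 1, by omega, h⟩
    · exact Finset.countable_toSet _
    · intro C hC
      obtain ⟨B, hB, rfl⟩ := hrep C hC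
      obtain ⟨d, n, h, -, hlen, -⟩ := hg B hB
      rw [h, ediam_interior_cylinder]
      exact (ENNReal.ofReal_le_ofReal hlen).trans hε
    · intro C hC
      obtain ⟨B, hB, rfl⟩ := hrep C hC
      obtain ⟨d, n, h, ⟨x, ⟨_, hxS⟩, hxC⟩, -⟩ := hg B hB
      exact ⟨x, hxC, hxS⟩
    · intro C hC C' hC' hne
      obtain ⟨B, hB, rfl⟩ := hrep C hC
      obtain ⟨B', hB', rfl⟩ := hrep C' hC'
      obtain ⟨d, n, h, -, h1, h2, -⟩ := hg B hB
      obtain ⟨d', n', h', -, h1', h2', -⟩ := hg B' hB'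
      have := disjoint_or_eq h1 h2 h1' h2'
      rw [← h, ← h'] at this
      exact this.resolve_right hne
  have hK : ∑ C ∈ F.image g, Metric.ediam C ^ (α : ℝ) ≤
      packingPre Q.cylinderInteriors α ε S := by
    refine le_trans (le_of_eq ?_) (le_iSup₂ (f := fun (V : Set (Set ℝ))
      (_ : IsUncenteredPacking Q.cylinderInteriors ε S V) =>
        ∑' B : V, Metric.ediam (B : Set ℝ) ^ (α : ℝ)) _ hpack)
    exact (Finset.tsum_subtype' (F.image g) fun C : Set ℝ => Metric.ediam C ^ (α : ℝ)).symm
  -- The lower bound `c * t ^ s` on the length of `C` trades `t ^ β` for the `α`-power of that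
  -- length.
  have hsmall : ∀ C ∈ F.image g, ENNReal.ofReal (t ^ (β : ℝ)) ≤
      ENNReal.ofReal ((c ^ (α : ℝ))⁻¹ * t ^ (β - s * α : ℝ)) * Metric.ediam C ^ (α : ℝ) := by
    intro C hC
    obtain ⟨B, hB, rfl⟩ := Finset.mem_image.1 hC
    obtain ⟨d, n, h, -, -, -, hlen⟩ := hg B hB
    rw [h, ediam_interior_cylinder, ENNReal.ofReal_rpow_of_nonneg (len_pos d _).le α.coe_nonneg,
      ← ENNReal.ofReal_mul (by positivity)]
    refine ENNReal.ofReal_le_ofReal ?_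
    have h1 : (c * t ^ s) ^ (α : ℝ) ≤ Q.len d (n + 1) ^ (α : ℝ) :=
      Real.rpow_le_rpow (by positivity) hlen α.coe_nonneg
    rw [Real.mul_rpow hc.le (by positivity), ← Real.rpow_mul ht0.le] at h1
    calc t ^ (β : ℝ) = (c ^ (α : ℝ))⁻¹ * t ^ (β - s * α : ℝ) * (c ^ (α : ℝ) * t ^ (s * α)) := by
          have h2 : (c ^ (α : ℝ)) ≠ 0 := by positivity
          have h3 : t ^ (β - s * α : ℝ) * t ^ (s * α) = t ^ (β : ℝ) := by
            rw [← Real.rpow_add ht0, sub_add_cancel]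
          rw [← h3]
          field_simp
      _ ≤ _ := mul_le_mul_of_nonneg_left h1 (by positivity)
  calc ∑ B ∈ F, Metric.ediam B ^ (β : ℝ) ≤ ∑ _B ∈ F, ENNReal.ofReal (t ^ (β : ℝ)) := by
        refine Finset.sum_le_sum fun B hB => ?_
        rw [← ENNReal.ofReal_rpow_of_nonneg ht0.le β.coe_nonneg]
        exact ENNReal.rpow_le_rpow (hup B hB) β.coe_nonneg
    _ = F.card * ENNReal.ofReal (t ^ (β : ℝ)) := by rw [Finset.sum_const, nsmul_eq_mul]
    _ ≤ (6 * (F.image g).card : ℕ) * ENNReal.ofReal (t ^ (β : ℝ)) := by gcongr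
    _ = 6 * ∑ _C ∈ F.image g, ENNReal.ofReal (t ^ (β : ℝ)) := by
        rw [Finset.sum_const, nsmul_eq_mul, Nat.cast_mul, mul_assoc]
        rfl
    _ ≤ 6 * ∑ C ∈ F.image g, ENNReal.ofReal ((c ^ (α : ℝ))⁻¹ * t ^ (β - s * α : ℝ)) *
          Metric.ediam C ^ (α : ℝ) := by
        gcongr with C hC
        exact hsmall C hC
    _ ≤ 6 * (ENNReal.ofReal ((c ^ (α : ℝ))⁻¹ * t ^ (β - s * α : ℝ)) *
          packingPre Q.cylinderInteriors α ε S) := by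
        rw [← Finset.mul_sum]
        gcongr
    _ = _ := by
        rw [ENNReal.ofReal_mul (by positivity), ENNReal.ofReal_mul (by norm_num)]
        simp only [ENNReal.ofReal_ofNat]
        ring

/-- Sorting the balls into dyadic size classes leaves a finite constant times a geometric tail,
which vanishes as the scale shrinks. -/
theorem packingQuasi_openBalls_eq_zero {s c : ℝ} (hs : 0 ≤ s) (hc : 0 < c)
    {S : Set ℝ} (hS : S ⊆ Q.regularPoints s c) {α β : ℝ≥0} (hβ : s * α < β)
    (hfin : packingQuasi Q.cylinderInteriors α S < ⊤) :
    packingQuasi (openBalls ℝ) β S = 0 := by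
  classical
  obtain ⟨ε, hε0, hεfin⟩ : ∃ ε > 0, packingPre Q.cylinderInteriors α ε S < ⊤ := by
    simpa [packingQuasi, iInf_lt_iff] using hfin
  set γ : ℝ := β - s * α
  have hγ0 : 0 < γ := sub_pos.2 hβ
  let t : ℕ → ℝ := fun m => (1 / 2 : ℝ) ^ (m + 1)
  have ht0 : ∀ m, 0 < t m := fun m => by positivity
  have ht1 : ∀ m, t m < 1 := fun m => pow_lt_one₀ (by norm_num) (by norm_num) (by omega)
  have htlim : Tendsto (fun m => ENNReal.ofReal (t m)) atTop (𝓝 0) := by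
    have h1 : Tendsto t atTop (𝓝 0) := (tendsto_add_atTop_iff_nat 1).2
      (tendsto_pow_atTop_nhds_zero_of_lt_one (by norm_num) (by norm_num))
    simpa using ENNReal.tendsto_ofReal h1
  set A : ℝ≥0∞ := ENNReal.ofReal (6 * (c ^ (α : ℝ))⁻¹) *
    packingPre Q.cylinderInteriors α ε S
  have hAtop : A ≠ ⊤ := ENNReal.mul_ne_top ENNReal.ofReal_ne_top hεfin.ne
  let w : ℕ → ℝ≥0∞ := fun m => ENNReal.ofReal (t m ^ γ)
  have hw : ∑' m, w m ≠ ⊤ := by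
    have hr0 : 0 ≤ (1 / 2 : ℝ) ^ γ := by positivity
    have hr1 : (1 / 2 : ℝ) ^ γ < 1 := Real.rpow_lt_one (by norm_num) (by norm_num) hγ0
    have hsum : Summable fun m => t m ^ γ := by
      refine ((summable_nat_add_iff 1).2 (summable_geometric_of_lt_one hr0 hr1)).congr fun m => ?_
      simp only [t]
      rw [← Real.rpow_natCast, ← Real.rpow_natCast, ← Real.rpow_mul (by norm_num),
        ← Real.rpow_mul (by norm_num), mul_comm]
    exact hsum.tsum_ofReal_ne_top
  have hbound : ∀ m₀, ENNReal.ofReal (t m₀) ≤ ε →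
      packingPre (openBalls ℝ) β (ENNReal.ofReal (t m₀)) S ≤ A * ∑' m, w (m + m₀) := by
    refine fun m₀ hm₀ => iSup₂_le fun V hV => ?_
    let W : ℕ → Set (Set ℝ) := fun m => {B ∈ V | ENNReal.ofReal (t (m + m₀) / 2) ≤
      Metric.ediam B ∧ Metric.ediam B ≤ ENNReal.ofReal (t (m + m₀))}
    have hcover : V ⊆ ⋃ m, W m := by
      intro B hB
      have hdiam := hV.diam_le B hB
      have hpos : 0 < Metric.ediam B := by
        obtain ⟨x, r, hr, rfl⟩ := hV.subset hB
        rw [Real.ball_eq_Ioo, Real.ediam_Ioo, ENNReal.ofReal_pos]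
        linarith
      have hex : ∃ m, ENNReal.ofReal (t (m + 1 + m₀)) ≤ Metric.ediam B := by
        have h1 := (tendsto_add_atTop_iff_nat (1 + m₀)).2 htlim
        obtain ⟨m, hm⟩ := (h1.eventually (gt_mem_nhds hpos)).exists
        exact ⟨m, by rw [add_assoc]; exact hm.le⟩
      have hhalf : ∀ m, t (m + m₀) / 2 = t (m + 1 + m₀) := by
        intro m
        simp only [t]
        rw [show m + 1 + m₀ + 1 = m + m₀ + 1 + 1 by ring, pow_succ _ (m + m₀ + 1)]
        ring
      -- The first dyadic scale below the diameter fixes the class; by minimality, or by the bound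
      -- on the packing for the top class, the diameter is at most twice that scale.
      refine mem_iUnion.2 ⟨Nat.find hex, hB, ?_, ?_⟩
      · rw [hhalf]
        exact Nat.find_spec hex
      · rcases Nat.eq_zero_or_pos (Nat.find hex) with h0 | h0
        · rw [h0, zero_add]
          exact hdiam
        · obtain ⟨m, hm⟩ := Nat.exists_eq_succ_of_ne_zero h0.ne'
          have h2 := Nat.find_min hex (m := m) (by omega)
          rw [hm]
          exact (not_le.1 h2).le
    have hclass : ∀ m, ∑' B : W m, Metric.ediam (B : Set ℝ) ^ (β : ℝ) ≤ A * w (m + m₀) := by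
      intro m
      rw [ENNReal.tsum_eq_iSup_sum]
      refine iSup_le fun F => ?_
      have hFW : ∀ B ∈ F.map (Function.Embedding.subtype _), B ∈ W m := by
        intro B hB
        obtain ⟨B', -, rfl⟩ := Finset.mem_map.1 hB
        exact B'.2
      have hle : ENNReal.ofReal (t (m + m₀)) ≤ ε := by
        refine (ENNReal.ofReal_le_ofReal ?_).trans hm₀
        exact pow_le_pow_of_le_one (by norm_num) (by norm_num) (by omega)
      have := sum_ediam_rpow_le (α := α) (β := β) hs hc (ht0 (m + m₀)) (ht1 _) hS hle
        (F.map (Function.Embedding.subtype _)) (fun B hB => hV.subset (hFW B hB).1)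
        (hV.disjoint.subset fun B hB => (hFW B hB).1) (fun B hB => (hFW B hB).2.1)
        (fun B hB => (hFW B hB).2.2) (fun B hB => hV.meets B (hFW B hB).1)
      rw [Finset.sum_map] at this
      exact this
    calc ∑' B : V, Metric.ediam (B : Set ℝ) ^ (β : ℝ)
        ≤ ∑' B : ⋃ m, W m, Metric.ediam (B : Set ℝ) ^ (β : ℝ) :=
          ENNReal.tsum_mono_subtype (fun B : Set ℝ => Metric.ediam B ^ (β : ℝ)) hcover
      _ ≤ ∑' m, ∑' B : W m, Metric.ediam (B : Set ℝ) ^ (β : ℝ) :=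
          ENNReal.tsum_iUnion_le_tsum (fun B : Set ℝ => Metric.ediam B ^ (β : ℝ)) W
      _ ≤ ∑' m, A * w (m + m₀) := ENNReal.tsum_le_tsum hclass
      _ = A * ∑' m, w (m + m₀) := ENNReal.tsum_mul_left
  have hlim : Tendsto (fun m₀ => A * ∑' m, w (m + m₀)) atTop (𝓝 0) := by
    have := ENNReal.Tendsto.const_mul (a := A) (ENNReal.tendsto_sum_nat_add w hw)
      (Or.inr hAtop)
    simpa using this
  refine nonpos_iff_eq_zero.1 (ge_of_tendsto hlim ?_)
  filter_upwards [htlim.eventually (ge_mem_nhds hε0)] with m₀ hm₀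
  exact (iInf₂_le _ (ENNReal.ofReal_pos.2 (ht0 m₀))).trans (hbound m₀ hm₀)

theorem packingMeas_openBalls_eq_zero
    (hQ : ∀ d : Q.Digits, Tendsto (fun k : ℕ => Real.log (Q.q k (d k)) /
      Real.log (∏ j ∈ Finset.range k, Q.q j (d j))) atTop (𝓝 0))
    {E : Set ℝ} (hE : E ⊆ Icc 0 1) {α β : ℝ≥0} (hαβ : α < β)
    (hα : packingMeas Q.cylinderInteriors α E = 0) : packingMeas (openBalls ℝ) β E = 0 := by
  obtain ⟨δ, hδ, hδβ⟩ : ∃ δ : ℝ, 0 < δ ∧ (1 + δ) * α < β := by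
    have h1 : (α : ℝ) < β := hαβ
    have h2 : 0 ≤ (α : ℝ) := α.coe_nonneg
    -- Adding one to the denominator covers `α = 0` and makes `δ * α < β - α` strict.
    refine ⟨(β - α) / (α + 1), div_pos (sub_pos.2 h1) (by linarith), ?_⟩
    have h3 : (β - α : ℝ) / (α + 1) * α < β - α := by
      rw [div_mul_eq_mul_div, div_lt_iff₀ (by linarith)]
      nlinarith
    linarith
  -- Only the finiteness of each quasi-measure is needed; the gain comes from the larger exponent.
  obtain ⟨S, hS, hSsum⟩ : ∃ S : ℕ → Set ℝ, E ⊆ ⋃ j, S j ∧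
      ∑' j, packingQuasi Q.cylinderInteriors α (S j) < 1 := by
    have : packingMeas Q.cylinderInteriors α E < 1 := hα ▸ one_pos
    simpa [packingMeas, iInf_lt_iff] using this
  have hfin : ∀ j, packingQuasi Q.cylinderInteriors α (S j) < ⊤ := fun j =>
    ((ENNReal.le_tsum j).trans_lt hSsum).trans ENNReal.one_lt_top
  have hcount : Countable Q.endpoints := countable_endpoints.to_subtype
  refine packingMeas_eq_zero_of_countable_cover (ι := (ℕ × ℕ) ⊕ Q.endpoints)
    (Sum.elim (fun p => S p.1 ∩ Q.regularPoints (1 + δ) (1 / (p.2 + 1 : ℝ))) fun x => {x.1}) ?_ ?_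
  · intro x hx
    by_cases hx' : x ∈ Q.endpoints
    · exact mem_iUnion.2 ⟨Sum.inr ⟨x, hx'⟩, rfl⟩
    · obtain ⟨j, hj⟩ := mem_iUnion.1 (hS hx)
      obtain ⟨d, hd⟩ := exists_forall_mem_interior (hE hx) hx'
      have hlen : ∀ t > 0, ∃ n, Q.len d n ≤ t := fun t ht => exists_len_le hQ d ht
      obtain ⟨n, hn⟩ := hlen (1 / 2) (by norm_num)
      obtain ⟨p, hp⟩ := exists_mul_rpow_len_le (hQ d) ⟨n, by linarith⟩ hδ
      exact mem_iUnion.2 ⟨Sum.inl (j, p), hj, d, hd, hlen, hp⟩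
  · rintro (⟨j, p⟩ | x)
    · refine packingQuasi_openBalls_eq_zero (by linarith) (by positivity) inter_subset_right hδβ ?_
      exact (packingQuasi_le_of_subset Subset.rfl inter_subset_left).trans_lt (hfin j)
    · exact packingQuasi_singleton (zero_le.trans_lt hαβ) x.1

end QTildeMatrix

theorem mainTheorem6 (Q : QTildeMatrix)
    (hQ : ∀ d : Q.Digits,
      Tendsto (fun k : ℕ =>
          Real.log (Q.q k (d k)) / Real.log (∏ j ∈ Finset.range k, Q.q j (d j)))
        atTop (𝓝 0)) :
    IsFaithfulForPackingDim Q.cylinderInteriors (Icc (0 : ℝ) 1) := by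
  refine ⟨QTildeMatrix.cylinderInteriors_subset_openBalls, fun E hE => le_antisymm
    (packingDimWrt_le_of_subset QTildeMatrix.cylinderInteriors_subset_openBalls E) ?_⟩
  refine le_iInf₂ fun α hα => le_of_forall_gt fun b hb => ?_
  obtain ⟨β, hαβ, hβb⟩ := ENNReal.lt_iff_exists_nnreal_btwn.1 hb
  refine lt_of_le_of_lt ?_ hβb
  exact iInf₂_le β (QTildeMatrix.packingMeas_openBalls_eq_zero hQ hE
    (by exact_mod_cast hαβ) hα)
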